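/- **Setting.** Fix the number of groups $R$, an integer $p\ge 1$, a coefficient vector $\boldsymbol\beta=(\beta_1,\boldsymbol\beta_{-1}^T)^T\in\mathbb R^p$ and variances $\sigma_A^2\ge 0$, $\sigma_E^2>0$. The full data follow the linear mixed model $$y_{ij}=\mathbf x_{ij}^T\boldsymbol\beta+a_i+e_{ij},\qquad i=1,\dots,R,\ j=1,\dots,C_i,$$ with fixed (non-random) covariates $\mathbf x_{ij}=(1,\mathbf z_{ij}^T)^T\in\mathbb R^{p}$; the $a_i$ are i.i.d. with mean $0$ and variance $\sigma_A^2$, the $e_{ij}$ are i.i.d. with mean $0$ and variance $\sigma_E^2$, and the two families are independent. A subdata set of size $n=Rm$ consists of $m$ distinct units from each group, chosen from the covariates only (for instance by group-orthogonal subsampling, GOSS). Write $\mathbf Z_i^*\in\mathbb R^{m\times(p-1)}$ for the matrix with the selected $\mathbf z_{ij}^T$ of group $i$ as rows, $\mathbf X^*$ for the $n\times p$ matrix with the selected $\mathbf x_{ij}^T$ as rows and $\mathbf Y^*$ for the vector of selected responses. Let $\hat\sigma_A^2,\hat\sigma_E^2$ be estimators of $\sigma_A^2,\sigma_E^2$,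 let $$\hat{\mathbf V}^*=\hat\sigma_E^2\mathbf I_n+\hat\sigma_A^2\mathbf A^*,\qquad \breve{\boldsymbol\beta}^*=(\mathbf X^{*T}\hat{\mathbf V}^{*-1}\mathbf X^*)^{-1}\mathbf X^{*T}\hat{\mathbf V}^{*-1}\mathbf Y^*,$$ where $\mathbf A^*$ is block diagonal with $R$ blocks $\mathbf 1_m\mathbf 1_m^T$, and let $\breve{\boldsymbol\beta}^*_{-1}$ be $\breve{\boldsymbol\beta}^*$ without its first component. A two-level orthogonal array (OA) of strength two is a matrix with entries $\pm1$ in which all ordered pairs of levels appear equally often in any two distinct columns (and both levels appear equally often in every column, which matters only if there is a single column). **Theorem.** Consider a sequence of such data sets and subdata sets with $n=Rm\to\infty$ ($R$, $\boldsymbol\beta$ and the laws of $a_i$ and $e_{ij}$ fixed; the covariates, the $C_i$ and the selection may change along the sequence). Suppose that $\mathbf Z_i^*=\mathbf L_i^*+\mathbf D_i^*$ where each $\mathbf L_i^*$ is a two-level OA of strength two with $m$ runs and $p-1$ columns, and the largest absolute value of the entries of $\mathbf D_1^*,\dots,\mathbf D_R^*$ is $o(1)$. Suppose also that $\mathrm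 E|e_{ij}|^3<\infty$ and that $\hat\sigma_A^2$ and $\hat\sigma_E^2$ converge in probability to $\sigma_A^2$ and $\sigma_E^2$; if $\sigma_A^2=0$, suppose in addition that $\hat\sigma_A^2\ge 0$ almost surely. Then $$\sqrt n\,\bigl(\breve{\boldsymbol\beta}^*_{-1}-\boldsymbol\beta_{-1}\bigr)\stackrel{d}{\longrightarrow}N(\mathbf 0,\sigma_E^2\mathbf I_{p-1}).$$ -/

import Mathlib

open MeasureTheory ProbabilityTheory Filter Topology

/-- Two-level orthogonal array of strength two with `m` runs and `q` factors, on the levels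
`-1` and `1`: every ordered pair of levels appears equally often in any two distinct columns,
and both levels appear equally often in each column (for `q ≥ 2` the second requirement follows
from the first one; it is listed so that the case of a single column is covered). -/
structure IsTwoLevelOA {m q : ℕ} (L : Matrix (Fin m) (Fin q) ℝ) : Prop where
  level : ∀ j k, L j k = -1 ∨ L j k = 1
  balanced : ∀ k,
    (Finset.univ.filter fun j => L j k = -1).card = (Finset.univ.filter fun j => L j k = 1).card
  pairs : ∀ k l, k ≠ l → ∀ u v u' v' : ℝ,
    (u = -1 ∨ u = 1) → (v = -1 ∨ v = 1) → (u' = -1 ∨ u' = 1) → (v' = -1 ∨ v' = 1) →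
    (Finset.univ.filter fun j => L j k = u ∧ L j l = v).card =
      (Finset.univ.filter fun j => L j k = u' ∧ L j l = v').card

/-- Covariates of a full data set with `R` groups: group `i` has `C i` units, and unit `j` of
group `i` has the vector `z i j` of `q` non-constant covariates (so `p = q + 1`). -/
structure GroupedCovariates (R q : ℕ) where
  C : Fin R → ℕ
  z : (i : Fin R) → Fin (C i) → Fin q → ℝ

namespace GroupedCovariates

variable {R q : ℕ} (F : GroupedCovariates R q)

/-- The full covariate vector `x i j`, whose first component is `1`. -/
def x (i : Fin R) (j : Fin (F.C i)) : Fin (q + 1) → ℝ := Matrix.vecCons 1 (F.z i j)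

/-- The response `y i j = x i jᵀ β + a i + e i j` of the linear mixed model. -/
def y {Ω : Type*} (β : Fin (q + 1) → ℝ) (a : Fin R → Ω → ℝ)
    (e : (i : Fin R) → Fin (F.C i) → Ω → ℝ) (i : Fin R) (j : Fin (F.C i)) (ω : Ω) : ℝ :=
  F.x i j ⬝ᵥ β + a i ω + e i j ω

/-- A subdata selection with `m` (distinct) units from each group. -/
abbrev Selection (m : ℕ) : Type := (i : Fin R) → Fin m ↪ Fin (F.C i)

/-- The block `Z*_i` of selected non-constant covariates in group `i`. -/
def subZ {m : ℕ} (s : F.Selection m) (i : Fin R) : Matrix (Fin m) (Fin q) ℝ :=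
  Matrix.of fun j k => F.z i (s i j) k

/-- The subdata design matrix `X*`, with rows indexed by (group, position in the group). -/
def subX {m : ℕ} (s : F.Selection m) : Matrix (Fin R × Fin m) (Fin (q + 1)) ℝ :=
  Matrix.of fun ij => F.x ij.1 (s ij.1 ij.2)

/-- The subdata response vector `Y*`. -/
def subY {Ω : Type*} {m : ℕ} (s : F.Selection m) (β : Fin (q + 1) → ℝ) (a : Fin R → Ω → ℝ)
    (e : (i : Fin R) → Fin (F.C i) → Ω → ℝ) (ω : Ω) : Fin R × Fin m → ℝ :=
  fun ij => F.y β a e ij.1 (s ij.1 ij.2) ω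

end GroupedCovariates

/-- Probabilistic assumptions of the linear mixed model: the random effects `a i` have law `νA`,
the errors `e i j` have law `νE`, and all of these variables are mutually independent. -/
structure IsMixedModelNoise {Ω : Type*} [MeasurableSpace Ω] (P : Measure Ω) {R : ℕ}
    {C : Fin R → ℕ} (νA νE : Measure ℝ) (a : Fin R → Ω → ℝ)
    (e : (i : Fin R) → Fin (C i) → Ω → ℝ) : Prop where
  law_a : ∀ i, HasLaw (a i) νA P
  law_e : ∀ i j, HasLaw (e i j) νE P
  indep : iIndepFun (Sum.elim a fun u : (i : Fin R) × Fin (C i) => e u.1 u.2) P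

/-- The block-diagonal matrix `A*` with `R` blocks `1_m 1_mᵀ`. -/
def groupBlock (R m : ℕ) : Matrix (Fin R × Fin m) (Fin R × Fin m) ℝ :=
  Matrix.of fun u v => if u.1 = v.1 then 1 else 0

/-- `V* = σE² I_n + σA² A*`; the arguments are the two variance components. -/
def subV (R m : ℕ) (vA vE : ℝ) : Matrix (Fin R × Fin m) (Fin R × Fin m) ℝ :=
  vE • (1 : Matrix (Fin R × Fin m) (Fin R × Fin m) ℝ) + vA • groupBlock R m

/-- Generalized least squares `(Xᵀ V⁻¹ X)⁻¹ Xᵀ V⁻¹ Y`. -/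
noncomputable def gls {ι κ : Type*} [Fintype ι] [DecidableEq ι] [Fintype κ] [DecidableEq κ]
    (X : Matrix ι κ ℝ) (V : Matrix ι ι ℝ) (Y : ι → ℝ) : κ → ℝ :=
  ((X.transpose * V⁻¹ * X)⁻¹ * X.transpose * V⁻¹).mulVec Y

/-- The slope part of a coefficient vector: all components but the first one (the intercept). -/
def slopePart {q : ℕ} (b : Fin (q + 1) → ℝ) : EuclideanSpace ℝ (Fin q) :=
  WithLp.toLp 2 fun k => b k.succ

/-- Entrywise max norm of the matrix obtained by stacking the blocks `D i`
(the norm of a finite product of copies of `ℝ` is the sup norm). -/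
noncomputable def stackedMaxNorm {R m q : ℕ} (D : Fin R → Matrix (Fin m) (Fin q) ℝ) : ℝ :=
  ‖fun u : Fin R × Fin m × Fin q => D u.1 u.2.1 u.2.2‖

/-! Since `groupBlock` squares to m times itself, the inverse working covariance is a multiple of I
- θA with θ = vA/(vE + m vA), so θm < 1. If every block is an exact orthogonal array, its columns
sum to zero within each group. The intercept, the random effects and the θ-correction then all drop
out of the slope equations, and the stacked columns have Gram matrix n I. The scaled slope error is
exactly n^{-1/2} Σ L e, whatever the working variances.

For a perturbation of size δ, `abs_slope_sub_le` makes this quantitative by a deterministic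
inequality. It holds pathwise for all vA ≥ 0 and vE > 0, so the dependence between the variance
estimators and the noise is irrelevant. The estimated variances enter the bound only through the
factor m vE/(vE + m vA) on the random effects. By `exists_negligible_variance_events` this factor is
harmless: it stays bounded with high probability if σA² > 0, and the random effects vanish almost
surely if σA² = 0.

`GroupedCovariates.abs_scaled_slope_error_sub_le` absorbs the slopes on the right-hand side of the
inequality. The remaining terms are weighted noise sums that vanish in probability by Chebyshev
(`tendstoInMeasure_weighted_sum`). The main term has orthonormal, uniformly small weights and is
handled by `tendstoInDistribution_weighted_sum`; Slutsky's theorem combines the two. -/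

/-! ### Moments of orthogonal arrays and of their perturbations. -/

namespace IsTwoLevelOA

variable {m q : ℕ} {L : Matrix (Fin m) (Fin q) ℝ}

lemma sum_eq_zero (h : IsTwoLevelOA L) (k : Fin q) : ∑ j, L j k = 0 := by
  have h1 : ∀ j, L j k = (if L j k = 1 then 1 else 0) - (if L j k = -1 then 1 else 0) := by
    intro j
    rcases h.level j k with h | h <;> rw [h] <;> norm_num
  rw [Finset.sum_congr rfl fun j _ => h1 j, Finset.sum_sub_distrib, Finset.sum_boole,
    Finset.sum_boole, h.balanced k, sub_self]

lemma sum_mul_self (h : IsTwoLevelOA L) (k : Fin q) : ∑ j, L j k * L j k = m := by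
  have h1 : ∀ j, L j k * L j k = 1 := by
    intro j
    rcases h.level j k with h | h <;> rw [h] <;> norm_num
  simp [h1]

/-- The product is a signed sum of the indicators of the four level pairs, two of each sign, and
strength two makes their counts equal. -/
lemma sum_mul_eq_zero (h : IsTwoLevelOA L) {k l : Fin q} (hkl : k ≠ l) :
    ∑ j, L j k * L j l = 0 := by
  have h1 : ∀ j, L j k * L j l =
      ((if L j k = 1 ∧ L j l = 1 then 1 else 0) - (if L j k = 1 ∧ L j l = -1 then 1 else 0)) +
      ((if L j k = -1 ∧ L j l = -1 then 1 else 0) -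
        (if L j k = -1 ∧ L j l = 1 then 1 else 0)) := by
    intro j
    rcases h.level j k with h1 | h1 <;> rcases h.level j l with h2 | h2 <;> rw [h1, h2] <;>
      norm_num
  rw [Finset.sum_congr rfl fun j _ => h1 j, Finset.sum_add_distrib, Finset.sum_sub_distrib,
    Finset.sum_sub_distrib, Finset.sum_boole, Finset.sum_boole, Finset.sum_boole,
    Finset.sum_boole, h.pairs k l hkl 1 1 1 (-1) (by simp) (by simp) (by simp) (by simp),
    h.pairs k l hkl (-1) (-1) (-1) 1 (by simp) (by simp) (by simp) (by simp)]
  ring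

lemma sum_mul (h : IsTwoLevelOA L) (k l : Fin q) :
    ∑ j, L j k * L j l = if k = l then (m : ℝ) else 0 := by
  split_ifs with hkl
  · subst hkl; exact h.sum_mul_self k
  · exact h.sum_mul_eq_zero hkl

lemma abs_eq_one (h : IsTwoLevelOA L) (j : Fin m) (k : Fin q) : |L j k| = 1 := by
  rcases h.level j k with h | h <;> rw [h] <;> norm_num

end IsTwoLevelOA

/-- Column sums and Gram matrix of a small perturbation of an orthogonal array. -/
lemma IsTwoLevelOA.perturb {m q : ℕ} {L D : Matrix (Fin m) (Fin q) ℝ} (hL : IsTwoLevelOA L)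
    {δ : ℝ} (hδ0 : 0 ≤ δ) (hδ1 : δ ≤ 1) (hD : ∀ j k, |D j k| ≤ δ) :
    (∀ k, |∑ j, (L j k + D j k)| ≤ m * δ) ∧
    ∀ k l, |(if k = l then (m : ℝ) else 0) - ∑ j, (L j k + D j k) * (L j l + D j l)| ≤
      m * (3 * δ) := by
  constructor
  · intro k
    rw [Finset.sum_add_distrib, hL.sum_eq_zero, zero_add]
    refine (Finset.abs_sum_le_sum_abs _ _).trans ?_
    refine (Finset.sum_le_sum fun j _ => hD j k).trans ?_
    simp
  · intro k l
    have h1 : (if k = l then (m : ℝ) else 0) - ∑ j, (L j k + D j k) * (L j l + D j l) =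
        -∑ j, (L j k * D j l + D j k * L j l + D j k * D j l) := by
      rw [← hL.sum_mul, ← Finset.sum_sub_distrib, ← Finset.sum_neg_distrib]
      exact Finset.sum_congr rfl fun j _ => by ring
    rw [h1, abs_neg]
    refine (Finset.abs_sum_le_sum_abs _ _).trans ?_
    -- Entries of L have modulus one, so the terms cost δ, δ and δ² ≤ δ.
    have h2 : ∀ j, |L j k * D j l + D j k * L j l + D j k * D j l| ≤ 3 * δ := by
      intro j
      refine (abs_add_three _ _ _).trans ?_
      rw [abs_mul, abs_mul, abs_mul, hL.abs_eq_one, hL.abs_eq_one]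
      nlinarith [hD j k, hD j l, abs_nonneg (D j k), abs_nonneg (D j l)]
    refine (Finset.sum_le_sum fun j _ => h2 j).trans ?_
    simp

/-! ### The deterministic inequality for the slopes. -/

/-- A solution of the normal equations of generalized least squares with a compound symmetric
working covariance has slopes close to the least squares slopes of an orthogonal design. -/
lemma abs_slope_sub_le {R m q : ℕ} {L D : Fin R → Matrix (Fin m) (Fin q) ℝ}
    (hL : ∀ i, IsTwoLevelOA (L i)) {δ : ℝ} (hδ0 : 0 ≤ δ) (hδ1 : δ ≤ 1)
    (hD : ∀ i j k, |D i j k| ≤ δ) {θ : ℝ} (hθ0 : 0 ≤ θ) (hθ1 : θ * m < 1)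
    (α : Fin R → ℝ) (ε w : Fin R → Fin m → ℝ) (b : ℝ) (u : Fin q → ℝ)
    (hw : ∀ i j, w i j = α i + ε i j - b - ∑ l, (L i j l + D i j l) * u l)
    (h0 : ∑ i, ∑ j, (w i j - θ * ∑ j', w i j') = 0)
    (h1 : ∀ k, ∑ i, ∑ j, (L i j k + D i j k) * (w i j - θ * ∑ j', w i j') = 0) (k : Fin q) :
    |(R * m : ℝ) * u k - ∑ i, ∑ j, L i j k * ε i j| ≤
      |∑ i, ∑ j, D i j k * ε i j| +
      2 * δ * ((1 - θ * m) * m * ∑ i, |α i| + ∑ i, |∑ j, ε i j|) +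
      5 * δ * (R * m * ∑ l, |u l|) := by
  have hκ0 : 0 < 1 - θ * m := by linarith
  have hκ1 : 1 - θ * m ≤ 1 := by nlinarith [(Nat.cast_nonneg m : (0:ℝ) ≤ m)]
  have hm0 : (0:ℝ) ≤ m := Nat.cast_nonneg m
  have hR0 : (0:ℝ) ≤ R := Nat.cast_nonneg R
  set ζ : Fin R → Fin q → ℝ := fun i k => ∑ j, (L i j k + D i j k) with hζ
  set G : Fin R → Fin q → Fin q → ℝ := fun i k l =>
    ∑ j, (L i j k + D i j k) * (L i j l + D i j l) with hG
  set E : Fin R → ℝ := fun i => ∑ j, ε i j with hE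
  set S : Fin R → ℝ := fun i => ∑ j, w i j with hS
  have bζ : ∀ i k, |ζ i k| ≤ m * δ := fun i k => ((hL i).perturb hδ0 hδ1 (hD i)).1 k
  have bG : ∀ i k l, |(if k = l then (m:ℝ) else 0) - G i k l| ≤ m * (3 * δ) :=
    fun i k l => ((hL i).perturb hδ0 hδ1 (hD i)).2 k l
  have eS : ∀ i, S i = m * α i + E i - m * b - ∑ l, ζ i l * u l := by
    intro i
    simp only [hS, hw, hE, hζ, Finset.sum_sub_distrib, Finset.sum_add_distrib, Finset.sum_const,
      Finset.card_univ, Fintype.card_fin, nsmul_eq_mul]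
    rw [Finset.sum_comm]
    simp only [Finset.sum_mul, ← Finset.sum_add_distrib]
  -- The intercept equation is (1 - θm) Σ S = 0. Cancelling the factor leaves an equation free of θ,
  -- which determines the intercept b.
  have sS : ∑ i, S i = 0 := by
    have : (1 - θ * m) * ∑ i, S i = 0 := by
      rw [← h0, Finset.mul_sum]
      refine Finset.sum_congr rfl fun i _ => ?_
      rw [Finset.sum_sub_distrib]
      simp only [Finset.sum_const, Finset.card_univ, Fintype.card_fin, nsmul_eq_mul, hS]
      ring
    exact (mul_eq_zero.1 this).resolve_left hκ0.ne'
  have eb : (R * m : ℝ) * b = m * ∑ i, α i + ∑ i, E i - ∑ i, ∑ l, ζ i l * u l := by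
    simp only [eS, Finset.sum_sub_distrib, Finset.sum_add_distrib, Finset.sum_const,
      Finset.card_univ, Fintype.card_fin, nsmul_eq_mul, ← Finset.mul_sum] at sS
    linarith
  have key : ∀ i, ∑ j, (L i j k + D i j k) * (w i j - θ * S i) =
      (1 - θ * m) * (α i * ζ i k) + ∑ j, (L i j k + D i j k) * ε i j - θ * (ζ i k * E i)
        - (1 - θ * m) * b * ζ i k - ∑ l, (G i k l - θ * (ζ i k * ζ i l)) * u l := by
    intro i
    have e1 : ∑ j, (L i j k + D i j k) * (w i j - θ * S i) =
        ∑ j, (L i j k + D i j k) * w i j - θ * S i * ζ i k := by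
      have e0 : θ * S i * ζ i k = ∑ j, θ * S i * (L i j k + D i j k) :=
        Finset.mul_sum _ _ (θ * S i)
      rw [e0, ← Finset.sum_sub_distrib]
      exact Finset.sum_congr rfl fun j _ => by ring
    have e2 : ∑ j, (L i j k + D i j k) * w i j =
        α i * ζ i k + ∑ j, (L i j k + D i j k) * ε i j - b * ζ i k - ∑ l, G i k l * u l := by
      have : ∑ l, G i k l * u l =
          ∑ j, (L i j k + D i j k) * ∑ l, (L i j l + D i j l) * u l := by
        simp only [hG, Finset.sum_mul, Finset.mul_sum]
        rw [Finset.sum_comm]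
        exact Finset.sum_congr rfl fun j _ => Finset.sum_congr rfl fun l _ => by ring
      rw [this, hζ]
      simp only [Finset.mul_sum (s := Finset.univ (α := Fin m)) (a := α i),
        Finset.mul_sum (s := Finset.univ (α := Fin m)) (a := b)]
      rw [← Finset.sum_add_distrib, ← Finset.sum_sub_distrib, ← Finset.sum_sub_distrib]
      exact Finset.sum_congr rfl fun j _ => by rw [hw]; ring
    have e3 : ∑ l, (G i k l - θ * (ζ i k * ζ i l)) * u l =
        ∑ l, G i k l * u l - θ * ζ i k * ∑ l, ζ i l * u l := by
      rw [Finset.mul_sum, ← Finset.sum_sub_distrib]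
      exact Finset.sum_congr rfl fun j _ => by ring
    rw [e1, e2, e3, eS]
    ring
  -- Every term on the right contains D, a column sum ζ or a Gram defect, so it vanishes for exact
  -- arrays and is of order δ otherwise.
  have main : (R * m : ℝ) * u k - ∑ i, ∑ j, L i j k * ε i j =
      ∑ i, ∑ j, D i j k * ε i j + (1 - θ * m) * ∑ i, α i * ζ i k - θ * ∑ i, ζ i k * E i
        - (1 - θ * m) * b * ∑ i, ζ i k
        + ∑ i, ∑ l, ((if k = l then (m:ℝ) else 0) - G i k l + θ * (ζ i k * ζ i l)) * u l := by
    have hk := h1 k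
    rw [Finset.sum_congr rfl fun i _ => key i] at hk
    simp only [Finset.sum_sub_distrib, Finset.sum_add_distrib, ← Finset.mul_sum, add_mul] at hk
    have e4 : ∑ i, ∑ l, ((if k = l then (m:ℝ) else 0) - G i k l + θ * (ζ i k * ζ i l)) * u l =
        (R * m : ℝ) * u k - ∑ i, ∑ l, (G i k l - θ * (ζ i k * ζ i l)) * u l := by
      have : (R * m : ℝ) * u k = ∑ i : Fin R, ∑ l, (if k = l then (m:ℝ) else 0) * u l := by
        simp [ite_mul, mul_assoc]
      rw [this, ← Finset.sum_sub_distrib]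
      refine Finset.sum_congr rfl fun i _ => ?_
      rw [← Finset.sum_sub_distrib]
      exact Finset.sum_congr rfl fun j _ => by ring
    rw [e4]
    linarith
  have hA : (0:ℝ) ≤ ∑ i, |α i| := Finset.sum_nonneg fun i _ => abs_nonneg _
  have hE0 : (0:ℝ) ≤ ∑ i, |E i| := Finset.sum_nonneg fun i _ => abs_nonneg _
  have hU : (0:ℝ) ≤ ∑ l, |u l| := Finset.sum_nonneg fun i _ => abs_nonneg _
  have hmδ : 0 ≤ m * δ := mul_nonneg hm0 hδ0
  have b1 : |(1 - θ * m) * ∑ i, α i * ζ i k| ≤ (1 - θ * m) * (m * δ * ∑ i, |α i|) := by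
    rw [abs_mul, abs_of_pos hκ0]
    refine mul_le_mul_of_nonneg_left ?_ hκ0.le
    rw [Finset.mul_sum]
    refine (Finset.abs_sum_le_sum_abs _ _).trans (Finset.sum_le_sum fun i _ => ?_)
    rw [abs_mul, mul_comm]
    exact mul_le_mul_of_nonneg_right (bζ i k) (abs_nonneg _)
  -- The factor m in the bound on ζ is paid for by θm < 1.
  have b2 : |θ * ∑ i, ζ i k * E i| ≤ δ * ∑ i, |E i| := by
    have : |∑ i, ζ i k * E i| ≤ m * δ * ∑ i, |E i| := by
      rw [Finset.mul_sum]
      refine (Finset.abs_sum_le_sum_abs _ _).trans (Finset.sum_le_sum fun i _ => ?_)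
      rw [abs_mul]
      exact mul_le_mul_of_nonneg_right (bζ i k) (abs_nonneg _)
    rw [abs_mul, abs_of_nonneg hθ0]
    calc θ * |∑ i, ζ i k * E i| ≤ θ * (m * δ * ∑ i, |E i|) := mul_le_mul_of_nonneg_left this hθ0
      _ = (θ * m) * (δ * ∑ i, |E i|) := by ring
      _ ≤ 1 * (δ * ∑ i, |E i|) := mul_le_mul_of_nonneg_right hθ1.le (mul_nonneg hδ0 hE0)
      _ = _ := one_mul _
  have b3 : |∑ i, ∑ l, ζ i l * u l| ≤ R * m * (δ * ∑ l, |u l|) := by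
    have : ∀ i, |∑ l, ζ i l * u l| ≤ m * (δ * ∑ l, |u l|) := by
      intro i
      rw [← mul_assoc, Finset.mul_sum]
      refine (Finset.abs_sum_le_sum_abs _ _).trans (Finset.sum_le_sum fun l _ => ?_)
      rw [abs_mul]
      exact mul_le_mul_of_nonneg_right (bζ i l) (abs_nonneg _)
    refine (Finset.abs_sum_le_sum_abs _ _).trans ((Finset.sum_le_sum fun i _ => this i).trans ?_)
    simp [mul_assoc]
  have b4 : R * m * |b| ≤ m * ∑ i, |α i| + ∑ i, |E i| + R * m * (δ * ∑ l, |u l|) := by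
    have h : |(R * m : ℝ) * b| = R * m * |b| := by
      rw [abs_mul, abs_of_nonneg (mul_nonneg hR0 hm0)]
    rw [← h, eb]
    have c1 : |(m:ℝ) * ∑ i, α i| ≤ m * ∑ i, |α i| := by
      rw [abs_mul, abs_of_nonneg hm0]
      exact mul_le_mul_of_nonneg_left (Finset.abs_sum_le_sum_abs _ _) hm0
    have c2 : |∑ i, E i| ≤ ∑ i, |E i| := Finset.abs_sum_le_sum_abs _ _
    refine (abs_sub _ _).trans ?_
    have := abs_add_le ((m:ℝ) * ∑ i, α i) (∑ i, E i)
    linarith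
  have b5 : |(1 - θ * m) * b * ∑ i, ζ i k| ≤
      δ * ((1 - θ * m) * m * ∑ i, |α i| + ∑ i, |E i| + R * m * ∑ l, |u l|) := by
    have c : |∑ i, ζ i k| ≤ R * m * δ := by
      refine (Finset.abs_sum_le_sum_abs _ _).trans
        ((Finset.sum_le_sum fun i _ => bζ i k).trans ?_)
      simp [mul_assoc]
    rw [abs_mul, abs_mul, abs_of_pos hκ0]
    have hRU : 0 ≤ R * m * (∑ l, |u l|) := by positivity
    calc (1 - θ * m) * |b| * |∑ i, ζ i k| ≤ (1 - θ * m) * |b| * (R * m * δ) := by gcongr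
      _ = δ * ((1 - θ * m) * (R * m * |b|)) := by ring
      _ ≤ δ * ((1 - θ * m) * (m * ∑ i, |α i| + ∑ i, |E i| + R * m * (δ * ∑ l, |u l|))) := by
        gcongr
      _ = δ * ((1 - θ * m) * m * ∑ i, |α i| + (1 - θ * m) * ∑ i, |E i| +
            (1 - θ * m) * (δ * (R * m * ∑ l, |u l|))) := by ring
      _ ≤ δ * ((1 - θ * m) * m * ∑ i, |α i| + 1 * ∑ i, |E i| +
            1 * (1 * (R * m * ∑ l, |u l|))) := by gcongr
      _ = _ := by ring
  -- 4 = 3 + 1: the Gram defect gives 3δm, and θζζ gives at most δm, again by θm < 1.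
  have b6 : |∑ i, ∑ l, ((if k = l then (m:ℝ) else 0) - G i k l + θ * (ζ i k * ζ i l)) * u l| ≤
      4 * δ * (R * m * ∑ l, |u l|) := by
    have c1 : ∀ i l, |(if k = l then (m:ℝ) else 0) - G i k l + θ * (ζ i k * ζ i l)| ≤
        4 * δ * m := by
      intro i l
      refine (abs_add_le _ _).trans ?_
      have : |θ * (ζ i k * ζ i l)| ≤ δ * m := by
        rw [abs_mul, abs_mul, abs_of_nonneg hθ0]
        calc θ * (|ζ i k| * |ζ i l|) ≤ θ * ((m * δ) * (m * δ)) := by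
              gcongr
              · exact bζ i k
              · exact bζ i l
          _ = (θ * m) * (δ * (m * δ)) := by ring
          _ ≤ 1 * (1 * (m * δ)) := by gcongr
          _ = δ * m := by ring
      have := bG i k l
      linarith
    have c2 : ∀ i, |∑ l, ((if k = l then (m:ℝ) else 0) - G i k l + θ * (ζ i k * ζ i l)) * u l| ≤
        4 * δ * m * ∑ l, |u l| := by
      intro i
      rw [Finset.mul_sum]
      refine (Finset.abs_sum_le_sum_abs _ _).trans (Finset.sum_le_sum fun l _ => ?_)
      rw [abs_mul]
      exact mul_le_mul_of_nonneg_right (c1 i l) (abs_nonneg _)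
    refine (Finset.abs_sum_le_sum_abs _ _).trans ((Finset.sum_le_sum fun i _ => c2 i).trans ?_)
    simp only [Finset.sum_const, Finset.card_univ, Fintype.card_fin, nsmul_eq_mul]
    exact le_of_eq (by ring)
  -- The noise terms occur directly (`b1`, `b2`) and through the intercept (`b5`), hence the 2; the
  -- slopes contribute 4 from `b6` and 1 from `b5`.
  rw [main]
  refine (abs_add_le _ _).trans ?_
  refine (add_le_add_left (abs_sub _ _) _).trans ?_
  refine (add_le_add_left (add_le_add_left (abs_sub _ _) _) _).trans ?_
  refine (add_le_add_left (add_le_add_left (add_le_add_left (abs_add_le _ _) _) _) _).trans ?_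
  linarith

/-! ### Normal equations and the compound symmetric covariance. -/

open Matrix in
/-- The normal equations of generalized least squares. -/
lemma gls_normal_equations {ι κ : Type*} [Fintype ι] [DecidableEq ι] [Fintype κ] [DecidableEq κ]
    {X : Matrix ι κ ℝ} {V : Matrix ι ι ℝ} (hX : IsUnit (Xᵀ * V⁻¹ * X).det) (Y : ι → ℝ) :
    Xᵀ *ᵥ (V⁻¹ *ᵥ (Y - X *ᵥ gls X V Y)) = 0 := by
  rw [Matrix.mulVec_sub, Matrix.mulVec_sub, gls, Matrix.mulVec_mulVec, Matrix.mulVec_mulVec,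
    Matrix.mulVec_mulVec, Matrix.mulVec_mulVec]
  have : Xᵀ * V⁻¹ * X * ((Xᵀ * V⁻¹ * X)⁻¹ * Xᵀ * V⁻¹) = Xᵀ * V⁻¹ := by
    rw [Matrix.mul_assoc (_⁻¹), ← Matrix.mul_assoc, Matrix.mul_nonsing_inv _ hX, Matrix.one_mul]
  simp only [← Matrix.mul_assoc] at this ⊢
  rw [this, sub_self]

lemma groupBlock_mul_self (R m : ℕ) :
    groupBlock R m * groupBlock R m = (m : ℝ) • groupBlock R m := by
  ext u v
  simp only [groupBlock, Matrix.mul_apply, Matrix.of_apply, Matrix.smul_apply, smul_eq_mul,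
    Fintype.sum_prod_type, mul_ite, mul_one, mul_zero]
  split_ifs with h
  · simp [h]
  · refine Finset.sum_eq_zero fun x _ => ?_
    by_cases h1 : x = v.1
    · have : u.1 ≠ x := fun h2 => h (h2.trans h1)
      simp [this]
    · simp [h1]

/-- As A² = mA, the span of I and A is closed under products, so the inverse can be sought there; vE
+ m vA is the eigenvalue of V on vectors constant within groups. -/
lemma subV_inv (R m : ℕ) {vA vE : ℝ} (hA : 0 ≤ vA) (hE : 0 < vE) :
    (subV R m vA vE)⁻¹ = vE⁻¹ • (1 - (vA / (vE + m * vA)) • groupBlock R m) := by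
  have h : vE + m * vA ≠ 0 := by positivity
  apply Matrix.inv_eq_right_inv
  simp only [subV, Matrix.mul_smul, mul_sub, add_mul, Matrix.smul_mul, groupBlock_mul_self,
    Matrix.one_mul, mul_one]
  ext u v
  simp only [Matrix.smul_apply, Matrix.add_apply, Matrix.sub_apply, smul_eq_mul]
  field_simp
  ring

lemma groupBlock_mulVec {R m : ℕ} (w : Fin R × Fin m → ℝ) (u : Fin R × Fin m) :
    (groupBlock R m).mulVec w u = ∑ j, w (u.1, j) := by
  simp only [Matrix.mulVec, dotProduct, groupBlock, Matrix.of_apply, Fintype.sum_prod_type,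
    ite_mul, one_mul, zero_mul]
  rw [Finset.sum_eq_single u.1] <;> simp +contextual [eq_comm]

lemma subV_inv_mulVec {R m : ℕ} {vA vE : ℝ} (hA : 0 ≤ vA) (hE : 0 < vE)
    (w : Fin R × Fin m → ℝ) (u : Fin R × Fin m) :
    (subV R m vA vE)⁻¹.mulVec w u =
      vE⁻¹ * (w u - vA / (vE + m * vA) * ∑ j, w (u.1, j)) := by
  rw [subV_inv R m hA hE, Matrix.smul_mulVec, Matrix.sub_mulVec, Matrix.one_mulVec,
    Matrix.smul_mulVec]
  simp [groupBlock_mulVec]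

namespace GroupedCovariates

variable {R q m : ℕ} (F : GroupedCovariates R q) (s : F.Selection m)

lemma subX_mulVec (b : Fin (q + 1) → ℝ) (i : Fin R) (j : Fin m) :
    (F.subX s).mulVec b (i, j) = b 0 + ∑ l, F.subZ s i j l * b l.succ := by
  simp [Matrix.mulVec, dotProduct, subX, x, subZ, Fin.sum_univ_succ]

lemma subX_transpose_mulVec_zero (w : Fin R × Fin m → ℝ) :
    (F.subX s).transpose.mulVec w 0 = ∑ i, ∑ j, w (i, j) := by
  simp [Matrix.mulVec, dotProduct, subX, x, Fintype.sum_prod_type]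

lemma subX_transpose_mulVec_succ (w : Fin R × Fin m → ℝ) (k : Fin q) :
    (F.subX s).transpose.mulVec w k.succ = ∑ i, ∑ j, F.subZ s i j k * w (i, j) := by
  simp [Matrix.mulVec, dotProduct, subX, x, subZ, Fintype.sum_prod_type]

end GroupedCovariates

open Matrix in
/-- Solutions of the generalized least squares normal equations, coordinatewise. -/
lemma GroupedCovariates.abs_slope_sub_le {R q m : ℕ} (F : GroupedCovariates R q)
    (s : F.Selection m)
    {L : Fin R → Matrix (Fin m) (Fin q) ℝ} (hL : ∀ i, IsTwoLevelOA (L i)) {δ : ℝ} (hδ0 : 0 ≤ δ)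
    (hδ1 : δ ≤ 1) (hD : ∀ i j k, |(F.subZ s i - L i) j k| ≤ δ)
    {vA vE : ℝ} (hA : 0 ≤ vA) (hE : 0 < vE) (α : Fin R → ℝ) (ε : Fin R → Fin m → ℝ)
    (b : Fin (q + 1) → ℝ)
    (h : (F.subX s)ᵀ *ᵥ ((subV R m vA vE)⁻¹ *ᵥ
      ((fun u => α u.1 + ε u.1 u.2) - F.subX s *ᵥ b)) = 0) (k : Fin q) :
    |(R * m : ℝ) * b k.succ - ∑ i, ∑ j, L i j k * ε i j| ≤
      |∑ i, ∑ j, (F.subZ s i - L i) j k * ε i j| +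
      2 * δ * (vE / (vE + m * vA) * m * ∑ i, |α i| + ∑ i, |∑ j, ε i j|) +
      5 * δ * (R * m * ∑ l : Fin q, |b l.succ|) := by
  have hp : 0 < vE + m * vA := by positivity
  have hκ : vE / (vE + m * vA) = 1 - vA / (vE + m * vA) * m := by field_simp; ring
  have hθ1 : vA / (vE + m * vA) * m < 1 := by
    have : 0 < vE / (vE + m * vA) := by positivity
    linarith
  have hadd : ∀ i j k, L i j k + (F.subZ s i - L i) j k = F.subZ s i j k := by
    intro i j k; simp
  rw [hκ]
  refine _root_.abs_slope_sub_le hL hδ0 hδ1 (D := fun i => F.subZ s i - L i) hD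
    (θ := vA / (vE + m * vA)) (by positivity) hθ1 α ε
    (fun i j => α i + ε i j - (F.subX s *ᵥ b) (i, j)) (b 0) (fun l => b l.succ) ?_ ?_ ?_ k
  · intro i j
    simp only [hadd, subX_mulVec]
    ring
  · have h0 := congrFun h 0
    rw [subX_transpose_mulVec_zero] at h0
    simp only [subV_inv_mulVec hA hE, ← Finset.mul_sum] at h0
    simpa using (mul_eq_zero.1 h0).resolve_left (inv_ne_zero hE.ne')
  · intro l
    have h0 := congrFun h l.succ
    rw [subX_transpose_mulVec_succ] at h0
    simp only [subV_inv_mulVec hA hE, mul_left_comm _ vE⁻¹, ← Finset.mul_sum] at h0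
    simp only [hadd]
    simpa using (mul_eq_zero.1 h0).resolve_left (inv_ne_zero hE.ne')

-- A null vector solves the normal equations with zero noise, so the slope inequality applies to it
-- and bounds each slope by 5δ times the sum of all of them. For small δ this forces the slopes to
-- vanish, and the intercept equation then kills the intercept.
open Matrix in
lemma GroupedCovariates.isUnit_det_normal {R q m : ℕ} (F : GroupedCovariates R q)
    (s : F.Selection m) (hn : 0 < R * m)
    {L : Fin R → Matrix (Fin m) (Fin q) ℝ} (hL : ∀ i, IsTwoLevelOA (L i)) {δ : ℝ} (hδ0 : 0 ≤ δ)
    (hδ1 : δ ≤ 1) (hδq : 10 * q * δ ≤ 1) (hD : ∀ i j k, |(F.subZ s i - L i) j k| ≤ δ)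
    {vA vE : ℝ} (hA : 0 ≤ vA) (hE : 0 < vE) :
    IsUnit ((F.subX s)ᵀ * (subV R m vA vE)⁻¹ * F.subX s).det := by
  rw [isUnit_iff_ne_zero]
  intro hdet
  obtain ⟨b, hb, hb0⟩ := Matrix.exists_mulVec_eq_zero_iff.2 hdet
  have hn' : (0:ℝ) < R * m := by exact_mod_cast hn
  have h : (F.subX s)ᵀ *ᵥ ((subV R m vA vE)⁻¹ *ᵥ
      ((fun _ : Fin R × Fin m => (0 : ℝ) + 0) - F.subX s *ᵥ b)) = 0 := by
    have : ((fun _ : Fin R × Fin m => (0 : ℝ) + 0) - F.subX s *ᵥ b) = -(F.subX s *ᵥ b) := by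
      ext u; simp
    rw [this, Matrix.mulVec_neg, Matrix.mulVec_neg, Matrix.mulVec_mulVec, Matrix.mulVec_mulVec,
      hb0, neg_zero]
  have hk := F.abs_slope_sub_le s hL hδ0 hδ1 hD hA hE (fun _ => 0) (fun _ _ => 0) b h
  simp only [mul_zero, Finset.sum_const_zero, sub_zero, abs_zero, add_zero, zero_add] at hk
  have hU : 0 ≤ ∑ l : Fin q, |b l.succ| := Finset.sum_nonneg fun _ _ => abs_nonneg _
  have hk' : ∀ k : Fin q, |b k.succ| ≤ 5 * δ * ∑ l : Fin q, |b l.succ| := by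
    intro k
    have := hk k
    rw [abs_mul, abs_of_pos hn'] at this
    refine le_of_mul_le_mul_left ?_ hn'
    linarith
  -- Summing over the q slopes gives U ≤ 5qδU ≤ U/2.
  have hU0 : ∑ l : Fin q, |b l.succ| = 0 := by
    have := Finset.sum_le_sum fun k (_ : k ∈ Finset.univ) => hk' k
    rw [Finset.sum_const, Finset.card_univ, Fintype.card_fin, nsmul_eq_mul] at this
    nlinarith
  have hs : ∀ l : Fin q, b l.succ = 0 := fun l => by
    have := (Finset.sum_eq_zero_iff_of_nonneg fun _ _ => abs_nonneg _).1 hU0 l (Finset.mem_univ l)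
    simpa using this
  have hi : b 0 = 0 := by
    have h0 := congrFun h 0
    rw [F.subX_transpose_mulVec_zero] at h0
    have hp : 0 < vE + m * vA := by positivity
    have hX : ∀ i j, (F.subX s *ᵥ b) (i, j) = b 0 := by
      intro i j
      rw [F.subX_mulVec]
      simp [hs]
    simp only [subV_inv_mulVec hA hE, Pi.sub_apply, hX, Finset.sum_const, Finset.card_univ,
      Fintype.card_fin, nsmul_eq_mul, Pi.zero_apply, zero_add, zero_sub] at h0
    have : (R * m : ℝ) * ((vE + m * vA)⁻¹ * b 0) = 0 := by
      rw [← neg_eq_zero, ← h0]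
      field_simp
      ring
    have := (mul_eq_zero.1 this).resolve_left hn'.ne'
    exact (mul_eq_zero.1 this).resolve_left (inv_ne_zero hp.ne')
  apply hb
  ext l
  exact Fin.cases (motive := fun l => b l = 0) hi hs l

/-! ### Measurability of the estimator with random working variances. -/

section Measurability

variable {Ω : Type*} [MeasurableSpace Ω] {P : Measure Ω}

lemma AEMeasurable.matrix_det {κ : Type*} [Fintype κ] [DecidableEq κ] {M : Ω → Matrix κ κ ℝ}
    (h : ∀ i j, AEMeasurable (fun ω => M ω i j) P) : AEMeasurable (fun ω => (M ω).det) P := by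
  simp only [Matrix.det_apply]
  refine Finset.aemeasurable_fun_sum _ fun σ _ => ?_
  exact (Finset.aemeasurable_fun_prod _ fun i _ => h _ _).const_smul _

/-- The adjugate formula holds for singular matrices too, with the inverse of a zero determinant
read as 0, so no invertibility is needed. -/
lemma AEMeasurable.matrix_inv {κ : Type*} [Fintype κ] [DecidableEq κ] {M : Ω → Matrix κ κ ℝ}
    (h : ∀ i j, AEMeasurable (fun ω => M ω i j) P) (i j : κ) :
    AEMeasurable (fun ω => (M ω)⁻¹ i j) P := by
  simp only [Matrix.inv_def, Ring.inverse_eq_inv', Matrix.smul_apply, smul_eq_mul,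
    Matrix.adjugate_apply]
  refine (AEMeasurable.matrix_det h).inv.mul (AEMeasurable.matrix_det fun k l => ?_)
  by_cases hk : k = j
  · subst hk
    simp
  · simpa [Matrix.updateRow_apply, hk] using h k l

lemma AEMeasurable.matrix_mul {ι κ μ : Type*} [Fintype κ] {M : Ω → Matrix ι κ ℝ}
    {N : Ω → Matrix κ μ ℝ} (hM : ∀ i j, AEMeasurable (fun ω => M ω i j) P)
    (hN : ∀ i j, AEMeasurable (fun ω => N ω i j) P) (i : ι) (j : μ) :
    AEMeasurable (fun ω => (M ω * N ω) i j) P := by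
  simp only [Matrix.mul_apply]
  exact Finset.aemeasurable_fun_sum _ fun k _ => (hM _ _).mul (hN _ _)

lemma AEMeasurable.gls {ι κ : Type*} [Fintype ι] [DecidableEq ι] [Fintype κ] [DecidableEq κ]
    (X : Matrix ι κ ℝ) {V : Ω → Matrix ι ι ℝ} {Y : Ω → ι → ℝ}
    (hV : ∀ i j, AEMeasurable (fun ω => V ω i j) P) (hY : ∀ i, AEMeasurable (fun ω => Y ω i) P)
    (k : κ) : AEMeasurable (fun ω => gls X (V ω) (Y ω) k) P := by
  have hVi := AEMeasurable.matrix_inv hV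
  have hN := AEMeasurable.matrix_inv (AEMeasurable.matrix_mul
    (AEMeasurable.matrix_mul (fun i j => aemeasurable_const (b := X.transpose i j)) hVi)
    (fun i j => aemeasurable_const (b := X i j)))
  have hT := AEMeasurable.matrix_mul (AEMeasurable.matrix_mul hN
    (fun i j => aemeasurable_const (b := X.transpose i j))) hVi
  exact Finset.aemeasurable_fun_sum _ fun i _ => (hT k i).mul (hY i)

end Measurability

/-! ### Chebyshev bound for weighted sums. -/

section WeightedSums

/-- Weighted sums of centered i.i.d. variables vanish in probability when the sums of the squared
weights do. -/
lemma tendstoInMeasure_weighted_sum {Ω : Type*} [MeasurableSpace Ω] {P : Measure Ω}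
    [IsProbabilityMeasure P] {ν : Measure ℝ} (hν : MemLp id 2 ν) (hmean : ∫ x, x ∂ν = 0)
    {ι : ℕ → Type*} [∀ t, Fintype (ι t)] {X : (t : ℕ) → ι t → Ω → ℝ}
    (hX : ∀ t i, HasLaw (X t i) ν P) (hind : ∀ t, iIndepFun (X t) P)
    {c : (t : ℕ) → ι t → ℝ} (hc : Tendsto (fun t => ∑ i, c t i ^ 2) atTop (𝓝 0)) :
    TendstoInMeasure P (fun t ω => ∑ i, c t i * X t i ω) atTop 0 := by
  have hL : ∀ t i, MemLp (fun ω => c t i * X t i ω) 2 P := by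
    intro t i
    refine MemLp.const_mul ?_ _
    have := hν
    rw [← (hX t i).map_eq] at this
    exact (memLp_map_measure_iff (by fun_prop) (hX t i).aemeasurable).1 this
  have hm : ∀ t i, ∫ ω, X t i ω ∂P = 0 := fun t i => by rw [(hX t i).integral_eq, hmean]
  have hmean' : ∀ t, ∫ ω, ∑ i, c t i * X t i ω ∂P = 0 := by
    intro t
    rw [integral_finsetSum _ fun i _ => (hL t i).integrable (by norm_num)]
    simp [integral_const_mul, hm]
  have hvar : ∀ t, Var[fun ω => ∑ i, c t i * X t i ω; P] = (∑ i, c t i ^ 2) * Var[id; ν] := by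
    intro t
    have h1 : (fun ω => ∑ i, c t i * X t i ω) = ∑ i, fun ω => c t i * X t i ω := by
      ext ω; simp
    rw [h1, IndepFun.variance_sum (fun i _ => hL t i), Finset.sum_mul]
    · refine Finset.sum_congr rfl fun i _ => ?_
      rw [variance_const_mul, (hX t i).variance_eq]
    · intro i _ j _ hij
      exact ((hind t).indepFun hij).comp (measurable_const_mul (c t i))
        (measurable_const_mul (c t j))
  rw [tendstoInMeasure_iff_norm]
  intro ε hε
  have hlim : Tendsto (fun t => ENNReal.ofReal ((∑ i, c t i ^ 2) * Var[id; ν] / ε ^ 2)) atTop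
      (𝓝 0) := by
    have := (hc.mul_const (Var[id; ν])).div_const (ε ^ 2)
    simpa using ENNReal.tendsto_ofReal this
  refine tendsto_of_tendsto_of_tendsto_of_le_of_le tendsto_const_nhds hlim
    (fun _ => zero_le) fun t => ?_
  have := meas_ge_le_variance_div_sq (memLp_finsetSum Finset.univ fun i _ => hL t i) hε
  rw [hmean', hvar] at this
  simpa using this

end WeightedSums

/-! ### Central limit theorem by characteristic functions. -/

section CentralLimit

/-- Factors are exchanged one at a time; all the others lie in the unit disc and do not enlarge the
difference. -/
lemma norm_prod_sub_prod_le_sum {ι : Type*} (s : Finset ι) (f g : ι → ℂ)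
    (hf : ∀ i, ‖f i‖ ≤ 1) (hg : ∀ i, ‖g i‖ ≤ 1) :
    ‖∏ i ∈ s, f i - ∏ i ∈ s, g i‖ ≤ ∑ i ∈ s, ‖f i - g i‖ := by
  classical
  induction s using Finset.induction_on with
  | empty => simp
  | insert a s ha ih =>
    rw [Finset.prod_insert ha, Finset.prod_insert ha, Finset.sum_insert ha]
    have h1 : ‖∏ i ∈ s, f i‖ ≤ 1 := by
      rw [norm_prod]
      exact Finset.prod_le_one (fun _ _ => norm_nonneg _) fun i _ => hf i
    calc ‖f a * ∏ i ∈ s, f i - g a * ∏ i ∈ s, g i‖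
        = ‖(f a - g a) * ∏ i ∈ s, f i + g a * (∏ i ∈ s, f i - ∏ i ∈ s, g i)‖ := by
          congr 1; ring
      _ ≤ ‖f a - g a‖ * ‖∏ i ∈ s, f i‖ + ‖g a‖ * ‖∏ i ∈ s, f i - ∏ i ∈ s, g i‖ := by
          refine (norm_add_le _ _).trans ?_
          rw [norm_mul, norm_mul]
      _ ≤ ‖f a - g a‖ * 1 + 1 * ∑ i ∈ s, ‖f i - g i‖ := by
          gcongr
          exact hg a
      _ = _ := by ring

/-- Second order expansion of the characteristic function of a centered law on `ℝ`. -/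
lemma charFun_sub_isLittleO {ν : Measure ℝ} [IsProbabilityMeasure ν]
    (hmean : ∫ x, x ∂ν = 0) (hvar : 0 < Var[id; ν]) :
    (fun t : ℝ => charFun ν t - (1 - (Var[id; ν] : ℂ) * t ^ 2 / 2)) =o[𝓝 0] fun t => t ^ 2 := by
  set σ := √(Var[id; ν]) with hσ
  have hσ0 : 0 < σ := Real.sqrt_pos.2 hvar
  have hσ2 : σ ^ 2 = Var[id; ν] := Real.sq_sqrt hvar.le
  have h2 : ∫ x, x ^ 2 ∂ν = Var[id; ν] := by
    rw [variance_eq_integral (by fun_prop)]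
    simp [hmean]
  -- The expansion is available for unit variance, so the law is rescaled by σ⁻¹ and the argument by
  -- σ afterwards.
  have hT := taylor_charFun_two (P := ν) (X := fun x => σ⁻¹ * x) (by fun_prop)
    (by rw [integral_const_mul, hmean, mul_zero])
    (by
      simp only [Pi.pow_apply, mul_pow]
      rw [integral_const_mul, h2, ← hσ2]
      field_simp)
  have hlim : Tendsto (fun t : ℝ => σ * t) (𝓝 0) (𝓝 0) := by
    have : Continuous fun t : ℝ => σ * t := by fun_prop
    simpa using this.tendsto 0
  have := hT.comp_tendsto hlim
  have h3 : (fun t : ℝ => t ^ 2) ∘ (fun t => σ * t) = fun t => σ ^ 2 * t ^ 2 := by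
    ext t; simp [mul_pow]
  rw [h3] at this
  refine (this.of_const_mul_right).congr_left fun t => ?_
  simp only [Function.comp_apply]
  rw [charFun_map_mul]
  rw [← hσ2, ← mul_assoc, inv_mul_cancel₀ hσ0.ne', one_mul]
  push_cast
  ring

/-- Lindeberg type limit of products of characteristic functions. -/
lemma tendsto_prod_charFun {ν : Measure ℝ} [IsProbabilityMeasure ν]
    (hmean : ∫ x, x ∂ν = 0) (hvar : 0 < Var[id; ν]) {ι : ℕ → Type*} [∀ t, Fintype (ι t)]
    {d : (t : ℕ) → ι t → ℝ} {B : ℕ → ℝ} (hB : Tendsto B atTop (𝓝 0))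
    (hdB : ∀ᶠ t in atTop, ∀ i, |d t i| ≤ B t) {τ : ℝ}
    (hτ : Tendsto (fun t => ∑ i, d t i ^ 2) atTop (𝓝 τ)) :
    Tendsto (fun t => ∏ i, charFun ν (d t i)) atTop
      (𝓝 (Complex.exp (-(Var[id; ν] * τ / 2 : ℝ)))) := by
  set v := Var[id; ν] with hv
  have hG : ∀ x : ℝ, charFun (gaussianReal 0 v.toNNReal) x = Complex.exp (-(v * x ^ 2 / 2 : ℝ)) := by
    intro x
    rw [charFun_gaussianReal]
    congr 1
    simp [Real.coe_toNNReal v hvar.le]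
  have hGm : ∫ x, x ∂(gaussianReal 0 v.toNNReal) = 0 := integral_id_gaussianReal
  have hGv : Var[id; gaussianReal 0 v.toNNReal] = v := by
    rw [variance_id_gaussianReal, Real.coe_toNNReal v hvar.le]
  -- Both laws have the expansion 1 - vt²/2, so it cancels; the Gaussian product is explicit and
  -- carries the limit.
  have hdiff : (fun t : ℝ => charFun ν t - charFun (gaussianReal 0 v.toNNReal) t) =o[𝓝 0]
      fun t => t ^ 2 := by
    have h1 := charFun_sub_isLittleO hmean hvar
    have h2 := charFun_sub_isLittleO (ν := gaussianReal 0 v.toNNReal) hGm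
      (by rw [hGv]; exact hvar)
    rw [hGv] at h2
    refine (h1.sub h2).congr_left fun t => ?_
    ring
  have hprodG : Tendsto (fun t => ∏ i, charFun (gaussianReal 0 v.toNNReal) (d t i)) atTop
      (𝓝 (Complex.exp (-(v * τ / 2 : ℝ)))) := by
    have : ∀ t, ∏ i, charFun (gaussianReal 0 v.toNNReal) (d t i) =
        Complex.exp (-(v * (∑ i, d t i ^ 2) / 2 : ℝ)) := by
      intro t
      simp only [hG]
      rw [← Complex.exp_sum]
      congr 1
      rw [Finset.mul_sum, Finset.sum_div]
      push_cast
      rw [Finset.sum_neg_distrib]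
    simp only [this]
    refine (Complex.continuous_exp.tendsto _).comp ?_
    have h := ((hτ.const_mul v).div_const 2).neg
    have := (Complex.continuous_ofReal.tendsto _).comp h
    simpa only [Function.comp_def, Complex.ofReal_neg] using this
  have hsub : Tendsto (fun t => ∏ i, charFun ν (d t i) -
      ∏ i, charFun (gaussianReal 0 v.toNNReal) (d t i)) atTop (𝓝 0) := by
    rw [Metric.tendsto_nhds]
    intro ε hε
    have hτ0 : 0 ≤ τ := ge_of_tendsto' hτ fun t => Finset.sum_nonneg fun i _ => sq_nonneg _
    -- The sum of squares is eventually below τ + 1, which keeps the total strictly below ε.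
    have hη : 0 < ε / (τ + 2) := by positivity
    obtain ⟨r, hr, hrb⟩ := Metric.eventually_nhds_iff.1 (hdiff.bound hη)
    filter_upwards [hdB, hB.eventually_lt_const hr, hτ.eventually_lt_const (lt_add_one τ)]
      with t h1 h2 h3
    rw [dist_zero_right]
    refine (norm_prod_sub_prod_le_sum _ _ _ (fun i => norm_charFun_le_one _)
      fun i => norm_charFun_le_one _).trans_lt ?_
    have : ∀ i, ‖charFun ν (d t i) - charFun (gaussianReal 0 v.toNNReal) (d t i)‖ ≤
        ε / (τ + 2) * d t i ^ 2 := by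
      intro i
      have := @hrb (d t i) (by simpa using (h1 i).trans_lt h2)
      simpa using this
    refine (Finset.sum_le_sum fun i _ => this i).trans_lt ?_
    rw [← Finset.mul_sum]
    calc ε / (τ + 2) * ∑ i, d t i ^ 2 < ε / (τ + 2) * (τ + 2) := by
          refine mul_lt_mul_of_pos_left (by linarith) hη
      _ = ε := by field_simp
  simpa using hsub.add hprodG

/-- Central limit theorem for weighted sums of i.i.d. variables with vector weights. -/
lemma tendstoInDistribution_weighted_sum {Ω : Type*} [MeasurableSpace Ω] {P : Measure Ω}
    [IsProbabilityMeasure P] {ν : Measure ℝ} [IsProbabilityMeasure ν]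
    (hmean : ∫ x, x ∂ν = 0)
    (hvar : 0 < Var[id; ν]) {ι : ℕ → Type*} [∀ t, Fintype (ι t)] {X : (t : ℕ) → ι t → Ω → ℝ}
    (hX : ∀ t i, HasLaw (X t i) ν P) (hind : ∀ t, iIndepFun (X t) P) {q : ℕ}
    {c : (t : ℕ) → ι t → Fin q → ℝ} {B : ℕ → ℝ} (hB : Tendsto B atTop (𝓝 0))
    (hcB : ∀ᶠ t in atTop, ∀ i k, |c t i k| ≤ B t)
    (hc : ∀ᶠ t in atTop, ∀ k l, ∑ i, c t i k * c t i l = if k = l then 1 else 0) :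
    TendstoInDistribution
      (fun t ω => (WithLp.toLp 2 fun k => ∑ i, c t i k * X t i ω : EuclideanSpace ℝ (Fin q)))
      atTop (id : EuclideanSpace ℝ (Fin q) → EuclideanSpace ℝ (Fin q)) (fun _ => P)
      (multivariateGaussian 0 (Var[id; ν] • (1 : Matrix (Fin q) (Fin q) ℝ))) := by
  have hmeas : ∀ t, AEMeasurable
      (fun ω => (WithLp.toLp 2 fun k => ∑ i, c t i k * X t i ω : EuclideanSpace ℝ (Fin q))) P := by
    intro t
    refine (WithLp.measurable_toLp 2 _).comp_aemeasurable (aemeasurable_pi_lambda _ fun k => ?_)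
    exact Finset.aemeasurable_fun_sum _ fun i _ => (hX t i).aemeasurable.const_mul _
  refine ⟨hmeas, by fun_prop, ?_⟩
  refine ProbabilityMeasure.tendsto_iff_tendsto_charFun.2 fun u => ?_
  simp only [ProbabilityMeasure.coe_mk, Measure.map_id]
  have hpsd : (Var[id; ν] • (1 : Matrix (Fin q) (Fin q) ℝ)).PosSemidef :=
    Matrix.PosSemidef.one.smul hvar.le
  rw [charFun_multivariateGaussian hpsd]
  -- Pairing with u turns the vector sum into a scalar sum with weights Σ_k c_k u_k, and
  -- independence factorizes it.
  have hchar : ∀ t, charFun (P.map fun ω => (WithLp.toLp 2 fun k => ∑ i, c t i k * X t i ω :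
      EuclideanSpace ℝ (Fin q))) u = ∏ i, charFun ν (∑ k, c t i k * u k) := by
    intro t
    have h1 : ∀ i, charFun ν (∑ k, c t i k * u k) =
        charFun (P.map fun ω => (∑ k, c t i k * u k) * X t i ω) 1 := by
      intro i
      rw [charFun_map_mul_comp (hX t i).aemeasurable, (hX t i).map_eq, mul_one]
    simp only [h1]
    have hind' : iIndepFun (fun i ω => (∑ k, c t i k * u k) * X t i ω) P :=
      (hind t).comp (fun i x => (∑ k, c t i k * u k) * x) fun i => by fun_prop
    have h2 := hind'.charFun_map_fun_sum_eq_prod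
      (fun i => (hX t i).aemeasurable.const_mul (∑ k, c t i k * u k))
    rw [← Finset.prod_apply, ← h2, charFun_apply, charFun_apply_real,
      integral_map (hmeas t) (by fun_prop), integral_map (Finset.aemeasurable_fun_sum _ fun i _ =>
        (hX t i).aemeasurable.const_mul _) (by fun_prop)]
    congr 1
    ext ω
    congr 1
    simp only [PiLp.inner_apply, Complex.ofReal_one, one_mul]
    congr 2
    simp only [Finset.sum_mul]
    rw [Finset.sum_comm]
    refine Finset.sum_congr rfl fun k _ => ?_
    simp [Finset.mul_sum]
    refine Finset.sum_congr rfl fun i _ => ?_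
    ring
  simp only [hchar]
  have hlim := tendsto_prod_charFun hmean hvar (d := fun t i => ∑ k, c t i k * u k)
    (B := fun t => B t * ∑ k, |u k|) (by simpa using hB.mul_const (∑ k, |u k|)) (by
      filter_upwards [hcB] with t ht i
      rw [Finset.mul_sum]
      refine (Finset.abs_sum_le_sum_abs _ _).trans (Finset.sum_le_sum fun k _ => ?_)
      rw [abs_mul]
      exact mul_le_mul_of_nonneg_right (ht i k) (abs_nonneg _))
    -- Orthonormality of the weight columns makes the sum of squared scalar weights equal to |u|².
    (τ := ∑ k, u k ^ 2) (by
      refine tendsto_const_nhds.congr' ?_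
      filter_upwards [hc] with t ht
      symm
      calc ∑ i, (∑ k, c t i k * u k) ^ 2
          = ∑ k, ∑ l, (∑ i, c t i k * c t i l) * (u k * u l) := by
            simp only [sq, Finset.sum_mul_sum]
            rw [Finset.sum_comm]
            refine Finset.sum_congr rfl fun k _ => ?_
            rw [Finset.sum_comm]
            refine Finset.sum_congr rfl fun l _ => ?_
            rw [Finset.sum_mul]
            exact Finset.sum_congr rfl fun i _ => by ring
        _ = ∑ k, u k ^ 2 := by
            simp [ht, sq])
  convert hlim using 2
  congr 1
  simp [Matrix.smul_mulVec, dotProduct, sq, Finset.mul_sum, mul_left_comm]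

end CentralLimit

/-! ### Calculus of convergence to zero in probability. -/

section InMeasure

variable {Ω : Type*} [MeasurableSpace Ω] {P : Measure Ω}

lemma tendstoInMeasure_zero_add {f g : ℕ → Ω → ℝ} (hf : TendstoInMeasure P f atTop 0)
    (hg : TendstoInMeasure P g atTop 0) : TendstoInMeasure P (fun t ω => f t ω + g t ω) atTop 0 := by
  rw [tendstoInMeasure_iff_norm] at *
  intro ε hε
  have h := (hf (ε / 2) (by positivity)).add (hg (ε / 2) (by positivity))
  rw [add_zero] at h
  refine tendsto_of_tendsto_of_tendsto_of_le_of_le tendsto_const_nhds h (fun _ => zero_le)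
    fun t => (measure_mono fun ω hω => ?_).trans (measure_union_le _ _)
  simp only [Pi.zero_apply, sub_zero, Set.mem_ofPred_eq, Set.mem_union] at hω ⊢
  by_contra! hc
  have := norm_add_le (f t ω) (g t ω)
  linarith

lemma tendstoInMeasure_zero_sum {ι : Type*} (s : Finset ι) {f : ι → ℕ → Ω → ℝ}
    (hf : ∀ i ∈ s, TendstoInMeasure P (f i) atTop 0) :
    TendstoInMeasure P (fun t ω => ∑ i ∈ s, f i t ω) atTop 0 := by
  classical
  induction s using Finset.induction_on with
  | empty =>
    rw [tendstoInMeasure_iff_norm]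
    intro ε hε
    simp [hε.not_ge]
  | insert a s ha ih =>
    simp only [Finset.sum_insert ha]
    exact tendstoInMeasure_zero_add (hf a (by simp)) (ih fun i hi => hf i (by simp [hi]))

lemma tendstoInMeasure_zero_abs {f : ℕ → Ω → ℝ} (hf : TendstoInMeasure P f atTop 0) :
    TendstoInMeasure P (fun t ω => |f t ω|) atTop 0 := by
  rw [tendstoInMeasure_iff_norm] at *
  simpa using hf

lemma tendstoInMeasure_zero_const_mul (c : ℝ) {f : ℕ → Ω → ℝ}
    (hf : TendstoInMeasure P f atTop 0) : TendstoInMeasure P (fun t ω => c * f t ω) atTop 0 := by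
  rw [tendstoInMeasure_iff_norm] at *
  intro ε hε
  have hc : 0 < |c| + 1 := by positivity
  refine tendsto_of_tendsto_of_tendsto_of_le_of_le tendsto_const_nhds
    (hf (ε / (|c| + 1)) (by positivity)) (fun _ => zero_le) fun t => measure_mono fun ω hω => ?_
  simp only [Pi.zero_apply, sub_zero, Set.mem_ofPred_eq, norm_mul, Real.norm_eq_abs] at hω ⊢
  rw [div_le_iff₀ hc]
  nlinarith [abs_nonneg (f t ω)]

/-- Domination outside of sets whose measures tend to zero. -/
lemma tendstoInMeasure_zero_of_dominated {E : Type*} [NormedAddCommGroup E] {f : ℕ → Ω → E}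
    {g : ℕ → Ω → ℝ} (hg : TendstoInMeasure P g atTop 0) {bad : ℕ → Set Ω}
    (hbad : Tendsto (fun t => P (bad t)) atTop (𝓝 0))
    (h : ∀ᶠ t in atTop, ∀ᵐ ω ∂P, ω ∉ bad t → ‖f t ω‖ ≤ g t ω) :
    TendstoInMeasure P f atTop 0 := by
  rw [tendstoInMeasure_iff_norm] at *
  intro ε hε
  have hlim := (hg ε hε).add hbad
  rw [add_zero] at hlim
  refine tendsto_of_tendsto_of_tendsto_of_le_of_le' tendsto_const_nhds hlim
    (Eventually.of_forall fun _ => zero_le) ?_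
  filter_upwards [h] with t ht
  refine (measure_mono_ae ?_).trans (measure_union_le _ _)
  filter_upwards [ht] with ω hω hmem
  by_cases hb : ω ∈ bad t
  · exact Or.inr hb
  · refine Or.inl ?_
    have h1 : ε ≤ ‖f t ω - (0 : ℕ → Ω → E) t ω‖ := hmem
    simp only [Pi.zero_apply, sub_zero] at h1
    change ε ≤ ‖g t ω - 0‖
    rw [sub_zero]
    exact (h1.trans (hω hb)).trans (le_abs_self _)

end InMeasure

/-! ### Pathwise control of the scaled error and of the variance estimates. -/

/-- The scaled slope error of the generalized least squares estimator is close to the scaled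
noise contrast of the orthogonal design. -/
lemma GroupedCovariates.abs_scaled_slope_error_sub_le {R q m : ℕ} (F : GroupedCovariates R q)
    (s : F.Selection m) (hn : 0 < R * m)
    {L : Fin R → Matrix (Fin m) (Fin q) ℝ} (hL : ∀ i, IsTwoLevelOA (L i)) {δ : ℝ} (hδ0 : 0 ≤ δ)
    (hδ1 : δ ≤ 1) (hδq : 10 * q * δ ≤ 1) (hD : ∀ i j k, |(F.subZ s i - L i) j k| ≤ δ)
    {vA vE : ℝ} (hA : 0 ≤ vA) (hE : 0 < vE) {Ω : Type*} (β : Fin (q + 1) → ℝ)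
    (a : Fin R → Ω → ℝ) (e : (i : Fin R) → Fin (F.C i) → Ω → ℝ) (ω : Ω) {K : ℝ}
    (hK : vE / (vE + m * vA) * m * ∑ i, |a i ω| ≤ K * ∑ i, |a i ω|) (k : Fin q) :
    |√((R * m : ℕ) : ℝ) * (gls (F.subX s) (subV R m vA vE) (F.subY s β a e ω) k.succ - β k.succ) -
        (√((R * m : ℕ) : ℝ))⁻¹ * ∑ i, ∑ j, L i j k * e i (s i j) ω| ≤
      11 * ∑ k, ((√((R * m : ℕ) : ℝ))⁻¹ * |∑ i, ∑ j, (F.subZ s i - L i) j k * e i (s i j) ω| +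
        2 * ((√((R * m : ℕ) : ℝ))⁻¹ * (K * ∑ i, |a i ω| + δ * ∑ i, |∑ j, e i (s i j) ω|))) +
      10 * δ * ∑ k, |(√((R * m : ℕ) : ℝ))⁻¹ * ∑ i, ∑ j, L i j k * e i (s i j) ω| := by
  have hnR : (0 : ℝ) < ((R * m : ℕ) : ℝ) := by exact_mod_cast hn
  set r := √((R * m : ℕ) : ℝ) with hr
  have hr0 : 0 < r := Real.sqrt_pos.2 hnR
  have hrr : (R * m : ℝ) = r * r := by
    rw [hr, Real.mul_self_sqrt hnR.le]; push_cast; rfl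
  set b := gls (F.subX s) (subV R m vA vE) (F.subY s β a e ω) - β with hb
  have hN := gls_normal_equations (F.isUnit_det_normal s hn hL hδ0 hδ1 hδq hD hA hE)
    (F.subY s β a e ω)
  have hY : F.subY s β a e ω - (F.subX s).mulVec (gls (F.subX s) (subV R m vA vE)
      (F.subY s β a e ω)) =
      (fun u => a u.1 ω + e u.1 (s u.1 u.2) ω) - (F.subX s).mulVec b := by
    rw [hb, Matrix.mulVec_sub]
    ext u
    simp only [Pi.sub_apply, subY, y, subX, Matrix.mulVec, Matrix.of_apply]
    ring
  rw [hY] at hN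
  have hS := F.abs_slope_sub_le s hL hδ0 hδ1 hD hA hE (fun i => a i ω)
    (fun i j => e i (s i j) ω) b hN
  have hbk : ∀ k : Fin q, gls (F.subX s) (subV R m vA vE) (F.subY s β a e ω) k.succ - β k.succ =
      b k.succ := fun k => rfl
  rw [hbk]
  set N : Fin q → ℝ := fun k => ∑ i, ∑ j, (F.subZ s i - L i) j k * e i (s i j) ω with hNdef
  set G : Fin q → ℝ := fun k => ∑ i, ∑ j, L i j k * e i (s i j) ω with hG
  set A := ∑ i, |a i ω| with hAdef
  set E := ∑ i, |∑ j, e i (s i j) ω| with hEdef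
  set U := ∑ l : Fin q, |r * b l.succ| with hU
  have hA0 : 0 ≤ A := Finset.sum_nonneg fun _ _ => abs_nonneg _
  have hE0 : 0 ≤ E := Finset.sum_nonneg fun _ _ => abs_nonneg _
  have hU0 : 0 ≤ U := Finset.sum_nonneg fun _ _ => abs_nonneg _
  have hKA : 0 ≤ K * A := le_trans (by positivity) hK
  set c : Fin q → ℝ := fun k => r⁻¹ * |N k| + 2 * (r⁻¹ * (K * A + δ * E)) with hc
  have hc0 : ∀ k, 0 ≤ c k := fun k => by positivity
  have step : ∀ k, |r * b k.succ - r⁻¹ * G k| ≤ c k + 5 * δ * U := by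
    intro k
    have h1 : r * b k.succ - r⁻¹ * G k = r⁻¹ * ((R * m : ℝ) * b k.succ - G k) := by
      rw [hrr]; field_simp
    rw [h1, abs_mul, abs_of_pos (inv_pos.2 hr0)]
    refine (mul_le_mul_of_nonneg_left (hS k) (inv_pos.2 hr0).le).trans ?_
    have h2 : U = r * ∑ l : Fin q, |b l.succ| := by
      rw [hU, Finset.mul_sum]
      exact Finset.sum_congr rfl fun l _ => by rw [abs_mul, abs_of_pos hr0]
    -- The factor δ is given up here, since r⁻¹ already makes the random effects negligible.
    have h3 : δ * (vE / (vE + m * vA) * m * A) ≤ K * A :=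
      (mul_le_of_le_one_left (by positivity) hδ1).trans hK
    have h4 : r⁻¹ * (r * r * ∑ l : Fin q, |b l.succ|) = U := by
      rw [h2]; field_simp
    rw [hrr]
    calc r⁻¹ * (|N k| + 2 * δ * (vE / (vE + m * vA) * m * A + E) +
          5 * δ * (r * r * ∑ l : Fin q, |b l.succ|))
        = r⁻¹ * |N k| + 2 * (r⁻¹ * (δ * (vE / (vE + m * vA) * m * A) + δ * E)) +
          5 * δ * (r⁻¹ * (r * r * ∑ l : Fin q, |b l.succ|)) := by ring
      _ ≤ c k + 5 * δ * U := by
          rw [h4]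
          change _ ≤ r⁻¹ * |N k| + 2 * (r⁻¹ * (K * A + δ * E)) + 5 * δ * U
          gcongr
  set g := ∑ k, |r⁻¹ * G k| with hg
  have hsum : U ≤ g + ∑ k, c k + q * (5 * δ * U) := by
    have : ∀ k, |r * b k.succ| ≤ |r⁻¹ * G k| + c k + 5 * δ * U := by
      intro k
      have h1 := step k
      have h2 := abs_sub_abs_le_abs_sub (r * b k.succ) (r⁻¹ * G k)
      linarith
    refine (Finset.sum_le_sum fun k _ => this k).trans ?_
    rw [Finset.sum_add_distrib, Finset.sum_add_distrib]
    simp [hg]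
  -- By 10qδ ≤ 1 the last term of `hsum` is at most U/2 and is absorbed.
  have hU2 : U ≤ 2 * (g + ∑ k, c k) := by nlinarith
  have hC0 : 0 ≤ ∑ k, c k := Finset.sum_nonneg fun k _ => hc0 k
  have hck : c k ≤ ∑ k, c k := Finset.single_le_sum (fun k _ => hc0 k) (Finset.mem_univ k)
  refine (step k).trans ?_
  have h5 : 5 * δ * U ≤ 10 * δ * g + 10 * ∑ k, c k := by
    have := mul_le_mul_of_nonneg_left hU2 (by positivity : 0 ≤ 5 * δ)
    nlinarith
  linarith

lemma EuclideanSpace.norm_le_sum_abs {q : ℕ} (x : EuclideanSpace ℝ (Fin q)) :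
    ‖x‖ ≤ ∑ k, |x k| := by
  rw [EuclideanSpace.norm_eq]
  refine Real.sqrt_le_iff.2 ⟨Finset.sum_nonneg fun _ _ => abs_nonneg _, ?_⟩
  exact Finset.sum_sq_le_sq_sum_of_nonneg fun i _ => abs_nonneg (x i)

/-- Off a sequence of events of vanishing probability, the estimated variance components are
admissible and the between-group noise is damped. -/
lemma exists_negligible_variance_events {R : ℕ} {Ω : Type*} [MeasurableSpace Ω] {P : Measure Ω}
    [IsProbabilityMeasure P] {νA : Measure ℝ} {σA2 σE2 : ℝ}
    (hA_sq : MemLp id 2 νA) (hA_mean : ∫ x, x ∂νA = 0) (hA_var : Var[id; νA] = σA2)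
    (hE_pos : 0 < σE2) {a : ℕ → Fin R → Ω → ℝ} (ha : ∀ t i, HasLaw (a t i) νA P)
    (m : ℕ → ℕ) {σA2hat σE2hat : ℕ → Ω → ℝ}
    (hAhat : TendstoInMeasure P σA2hat atTop fun _ => σA2)
    (hEhat : TendstoInMeasure P σE2hat atTop fun _ => σE2)
    (hAhat_nonneg : σA2 = 0 → ∀ t, ∀ᵐ ω ∂P, 0 ≤ σA2hat t ω) :
    ∃ (bad : ℕ → Set Ω) (K : ℝ), Tendsto (fun t => P (bad t)) atTop (𝓝 0) ∧
      ∀ t, ∀ᵐ ω ∂P, ω ∉ bad t → 0 ≤ σA2hat t ω ∧ 0 < σE2hat t ω ∧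
        σE2hat t ω / (σE2hat t ω + m t * σA2hat t ω) * m t * ∑ i, |a t i ω| ≤
          K * ∑ i, |a t i ω| := by
  rw [tendstoInMeasure_iff_norm] at hAhat hEhat
  have hE := hEhat (σE2 / 2) (by positivity)
  rcases (hA_var ▸ variance_nonneg id νA : 0 ≤ σA2).eq_or_lt with h0 | hpos
  -- When σA² = 0 the random effects are almost surely zero, so K = 0 works and only the error
  -- variance needs a bad event.
  · refine ⟨_, 0, hE, fun t => ?_⟩
    have ha0 : ∀ i, ∀ᵐ ω ∂P, a t i ω = 0 := by
      intro i
      have hL : MemLp (a t i) 2 P := by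
        rw [← (ha t i).map_eq] at hA_sq
        exact (memLp_map_measure_iff (by fun_prop) (ha t i).aemeasurable).1 hA_sq
      have := ae_eq_integral_of_variance_eq_zero hL
        (by rw [(ha t i).variance_eq, hA_var, h0])
      rwa [(ha t i).integral_eq, hA_mean] at this
    filter_upwards [hAhat_nonneg h0.symm t, ae_all_iff.2 ha0] with ω h1 h2 hb
    simp only [not_le, Real.norm_eq_abs, abs_lt] at hb
    refine ⟨h1, by linarith, by simp [h2]⟩
  · have hA := hAhat (σA2 / 2) (by positivity)
    -- Off both events the factor is at most vE/vA ≤ (3σE²/2)/(σA²/2), which is K.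
    refine ⟨fun t => {ω | σE2 / 2 ≤ ‖σE2hat t ω - σE2‖} ∪ {ω | σA2 / 2 ≤ ‖σA2hat t ω - σA2‖},
      3 * σE2 / σA2, ?_, fun t => Eventually.of_forall fun ω hb => ?_⟩
    · have := hE.add hA
      rw [add_zero] at this
      exact tendsto_of_tendsto_of_tendsto_of_le_of_le tendsto_const_nhds this (fun _ => zero_le)
        fun t => measure_union_le _ _
    · simp only [Set.mem_union, Set.mem_ofPred_eq, not_or, not_le, Real.norm_eq_abs, abs_lt] at hb
      have h1 : σA2 / 2 < σA2hat t ω := by linarith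
      have h2 : 0 < σE2hat t ω := by linarith
      have h3 : σE2hat t ω ≤ 3 / 2 * σE2 := by linarith
      have h4 : 0 < σA2hat t ω := by linarith
      refine ⟨h4.le, h2, mul_le_mul_of_nonneg_right ?_ (Finset.sum_nonneg fun _ _ => abs_nonneg _)⟩
      have hm : (0 : ℝ) ≤ m t := Nat.cast_nonneg _
      have hp : 0 < σE2hat t ω + m t * σA2hat t ω := by positivity
      rw [div_mul_eq_mul_div, div_le_div_iff₀ hp hpos]
      calc σE2hat t ω * m t * σA2 ≤ 3 / 2 * σE2 * m t * (2 * σA2hat t ω) := by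
            gcongr
            linarith
        _ = 3 * σE2 * (m t * σA2hat t ω) := by ring
        _ ≤ 3 * σE2 * (σE2hat t ω + m t * σA2hat t ω) := by
            gcongr
            linarith

/-! ### The limit theorem. -/

theorem theorem3 {R q : ℕ}
    {Ω : Type*} [MeasurableSpace Ω] (P : Measure Ω) [IsProbabilityMeasure P]
    -- model parameters: coefficients, laws of the random effects and of the errors
    (β : Fin (q + 1) → ℝ) (νA νE : Measure ℝ) (σA2 σE2 : ℝ)
    (hA_sq : MemLp id 2 νA) (hA_mean : ∫ x, x ∂νA = 0) (hA_var : Var[id; νA] = σA2)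
    (hE_mean : ∫ x, x ∂νE = 0) (hE_var : Var[id; νE] = σE2) (hE_pos : 0 < σE2)
    (hE_third : Integrable (fun x : ℝ => |x| ^ 3) νE)
    -- stage `t`: full data, subdata with `m t` units from each of the `R` groups
    (F : ℕ → GroupedCovariates R q)
    (a : ℕ → Fin R → Ω → ℝ) (e : (t : ℕ) → (i : Fin R) → Fin ((F t).C i) → Ω → ℝ)
    (hnoise : ∀ t, IsMixedModelNoise P νA νE (a t) (e t))
    (m : ℕ → ℕ) (hn : Tendsto (fun t => R * m t) atTop atTop)
    (s : (t : ℕ) → (F t).Selection (m t))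
    -- the deviation of the subdata from orthogonal arrays is `o(1)` in max norm
    (L : (t : ℕ) → Fin R → Matrix (Fin (m t)) (Fin q) ℝ) (hL : ∀ t i, IsTwoLevelOA (L t i))
    (hD : Tendsto (fun t => stackedMaxNorm fun i => (F t).subZ (s t) i - L t i) atTop (𝓝 0))
    -- consistent estimators of the variance components
    (σA2hat σE2hat : ℕ → Ω → ℝ)
    (hAhat_meas : ∀ t, AEMeasurable (σA2hat t) P) (hEhat_meas : ∀ t, AEMeasurable (σE2hat t) P)
    (hAhat : TendstoInMeasure P σA2hat atTop fun _ => σA2)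
    (hEhat : TendstoInMeasure P σE2hat atTop fun _ => σE2)
    (hAhat_nonneg : σA2 = 0 → ∀ t, ∀ᵐ ω ∂P, 0 ≤ σA2hat t ω) :
    TendstoInDistribution
      (fun (t : ℕ) (ω : Ω) =>
        √((R * m t : ℕ) : ℝ) •
          (slopePart (gls ((F t).subX (s t)) (subV R (m t) (σA2hat t ω) (σE2hat t ω))
            ((F t).subY (s t) β (a t) (e t) ω)) - slopePart β))
      atTop (id : EuclideanSpace ℝ (Fin q) → EuclideanSpace ℝ (Fin q)) (fun _ => P)
      (multivariateGaussian 0 (σE2 • (1 : Matrix (Fin q) (Fin q) ℝ))) := by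
  have hmeasT : ∀ t, AEMeasurable (fun ω => √((R * m t : ℕ) : ℝ) •
      (slopePart (gls ((F t).subX (s t)) (subV R (m t) (σA2hat t ω) (σE2hat t ω))
        ((F t).subY (s t) β (a t) (e t) ω)) - slopePart β)) P := by
    intro t
    suffices h : AEMeasurable (fun ω => slopePart (gls ((F t).subX (s t))
        (subV R (m t) (σA2hat t ω) (σE2hat t ω)) ((F t).subY (s t) β (a t) (e t) ω))) P from
      AEMeasurable.fun_const_smul (h.sub_const (slopePart β)) (√((R * m t : ℕ) : ℝ))
    refine (WithLp.measurable_toLp 2 _).comp_aemeasurable (aemeasurable_pi_lambda _ fun k => ?_)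
    refine AEMeasurable.gls _ (fun u v => ?_) (fun u => ?_) k.succ
    · exact ((hEhat_meas t).mul_const _).add ((hAhat_meas t).mul_const _)
    · exact (((hnoise t).law_a u.1).aemeasurable.const_add _).add
        ((hnoise t).law_e u.1 (s t u.1 u.2)).aemeasurable
  -- the noise of the selected units
  set X : (t : ℕ) → Fin R × Fin (m t) → Ω → ℝ := fun t v => e t v.1 (s t v.1 v.2) with hXdef
  have hX : ∀ t v, HasLaw (X t v) νE P := fun t v => (hnoise t).law_e _ _
  have hXind : ∀ t, iIndepFun (X t) P := by
    intro t
    -- Independence passes to the selected errors because the selected units are distinct.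
    refine (hnoise t).indep.precomp
      (g := fun v : Fin R × Fin (m t) => Sum.inr ⟨v.1, s t v.1 v.2⟩) ?_
    rintro ⟨i, j⟩ ⟨i', j'⟩ h
    obtain ⟨rfl, h2⟩ := Sigma.mk.inj_iff.1 (Sum.inr_injective h)
    exact congrArg (Prod.mk i) ((s t i).injective (eq_of_heq h2))
  have hνE : IsProbabilityMeasure νE := by
    obtain ⟨t, ht⟩ := (hn.eventually_gt_atTop 0).exists
    have hR : 0 < R := Nat.pos_of_mul_pos_right ht
    have hm : 0 < m t := Nat.pos_of_mul_pos_left ht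
    exact (hX t (⟨0, hR⟩, ⟨0, hm⟩)).isProbabilityMeasure_iff.1 inferInstance
  -- The variance is 0 by convention when the second moment is infinite, so a nonzero variance gives
  -- square integrability.
  have hE_sq : MemLp id 2 νE :=
    memLp_two_of_variance_ne_zero aestronglyMeasurable_id (by rw [hE_var]; exact hE_pos.ne')
  -- the sample size and the deviation
  set r : ℕ → ℝ := fun t => √((R * m t : ℕ) : ℝ) with hr
  have hr0 : ∀ t, 0 ≤ r t := fun t => Real.sqrt_nonneg _
  have hrlim : Tendsto (fun t => (r t)⁻¹) atTop (𝓝 0) :=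
    tendsto_inv_atTop_zero.comp
      (Real.tendsto_sqrt_atTop.comp (tendsto_natCast_atTop_atTop.comp hn))
  have hrsq : ∀ t, (r t)⁻¹ ^ 2 * (R * m t) ≤ 1 := by
    intro t
    have : (R * m t : ℝ) = r t ^ 2 := by
      rw [hr, Real.sq_sqrt (Nat.cast_nonneg _)]; push_cast; rfl
    rw [this, ← mul_pow]
    exact pow_le_one₀ (mul_nonneg (inv_nonneg.2 (hr0 t)) (hr0 t)) (inv_mul_le_one)
  set δ : ℕ → ℝ := fun t => stackedMaxNorm fun i => (F t).subZ (s t) i - L t i with hδ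
  have hδ0 : ∀ t, 0 ≤ δ t := fun t => norm_nonneg _
  have hDδ : ∀ t i j k, |((F t).subZ (s t) i - L t i) j k| ≤ δ t := fun t i j k =>
    norm_le_pi_norm (fun u : Fin R × Fin (m t) × Fin q =>
      ((F t).subZ (s t) u.1 - L t u.1) u.2.1 u.2.2) (i, j, k)
  have hδsq : Tendsto (fun t => δ t ^ 2) atTop (𝓝 0) := by simpa using hD.pow 2
  -- There are n = r² weights of size at most Mδ/r, so their squares sum to at most M²δ² → 0.
  have small : ∀ (M : ℝ) (c : (t : ℕ) → Fin R × Fin (m t) → ℝ),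
      (∀ t v, |c t v| ≤ (r t)⁻¹ * (M * δ t)) →
      TendstoInMeasure P (fun t ω => ∑ v, c t v * X t v ω) atTop 0 := by
    intro M c hc
    refine tendstoInMeasure_weighted_sum hE_sq hE_mean hX hXind ?_
    have hlim : Tendsto (fun t => M ^ 2 * δ t ^ 2) atTop (𝓝 0) := by
      simpa using hδsq.const_mul (M ^ 2)
    refine tendsto_of_tendsto_of_tendsto_of_le_of_le tendsto_const_nhds hlim
      (fun t => Finset.sum_nonneg fun _ _ => sq_nonneg _) fun t => ?_
    have : ∀ v, c t v ^ 2 ≤ ((r t)⁻¹ * (M * δ t)) ^ 2 := fun v => by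
      rw [← sq_abs]
      exact pow_le_pow_left₀ (abs_nonneg _) (hc t v) 2
    refine (Finset.sum_le_sum fun v _ => this v).trans ?_
    simp only [Finset.sum_const, Finset.card_univ, Fintype.card_prod, Fintype.card_fin,
      nsmul_eq_mul, Nat.cast_mul]
    calc (R * m t : ℝ) * ((r t)⁻¹ * (M * δ t)) ^ 2
        = ((r t)⁻¹ ^ 2 * (R * m t)) * (M ^ 2 * δ t ^ 2) := by ring
      _ ≤ 1 * (M ^ 2 * δ t ^ 2) := by
          gcongr
          exact hrsq t
      _ = _ := one_mul _
  obtain ⟨bad, K, hbad, hgood⟩ := exists_negligible_variance_events hA_sq hA_mean hA_var hE_pos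
    (fun t i => (hnoise t).law_a i) m hAhat hEhat hAhat_nonneg
  have hN : ∀ k, TendstoInMeasure P (fun t ω =>
      ∑ v, ((r t)⁻¹ * ((F t).subZ (s t) v.1 - L t v.1) v.2 k) * X t v ω) atTop 0 := by
    refine fun k => small 1 _ fun t v => ?_
    rw [abs_mul, abs_of_nonneg (inv_nonneg.2 (hr0 t)), one_mul]
    exact mul_le_mul_of_nonneg_left (hDδ t _ _ _) (inv_nonneg.2 (hr0 t))
  have hG : ∀ k, TendstoInMeasure P (fun t ω =>
      ∑ v, (δ t * ((r t)⁻¹ * L t v.1 v.2 k)) * X t v ω) atTop 0 := by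
    refine fun k => small 1 _ fun t v => le_of_eq ?_
    rw [abs_mul, abs_mul, abs_of_nonneg (inv_nonneg.2 (hr0 t)), (hL t v.1).abs_eq_one,
      abs_of_nonneg (hδ0 t)]
    ring
  have hE : ∀ i, TendstoInMeasure P (fun t ω =>
      ∑ v, (if v.1 = i then (r t)⁻¹ * δ t else 0) * X t v ω) atTop 0 := by
    refine fun i => small 1 _ fun t v => ?_
    have : 0 ≤ (r t)⁻¹ * δ t := mul_nonneg (inv_nonneg.2 (hr0 t)) (hδ0 t)
    split_ifs
    · rw [abs_of_nonneg this, one_mul]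
    · simpa using this
  -- A one-term weighted sum: the weight r⁻¹ tends to 0 because n → ∞, without help from δ.
  have hA : ∀ i, TendstoInMeasure P (fun t ω => ∑ _v : Unit, (r t)⁻¹ * a t i ω) atTop 0 := by
    intro i
    refine tendstoInMeasure_weighted_sum (ι := fun _ => Unit) (X := fun t _ => a t i)
      (c := fun t _ => (r t)⁻¹) hA_sq hA_mean (fun t _ => (hnoise t).law_a i) (fun t => ?_) ?_
    · exact (hnoise t).indep.precomp (g := fun _ : Unit => Sum.inl i) fun _ _ _ => rfl
    · simpa using hrlim.pow 2
  have hclt := tendstoInDistribution_weighted_sum hE_mean (hE_var ▸ hE_pos) hX hXind (q := q)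
    (c := fun t v k => (r t)⁻¹ * L t v.1 v.2 k) hrlim
    (Eventually.of_forall fun t v k => by
      rw [abs_mul, abs_of_nonneg (inv_nonneg.2 (hr0 t)), (hL t v.1).abs_eq_one, mul_one])
    (by
      filter_upwards [hn.eventually_gt_atTop 0] with t ht k l
      have hnR : (0 : ℝ) < ((R * m t : ℕ) : ℝ) := by exact_mod_cast ht
      have h1 : ∑ v : Fin R × Fin (m t), (r t)⁻¹ * L t v.1 v.2 k * ((r t)⁻¹ * L t v.1 v.2 l) =
          (r t ^ 2)⁻¹ * ∑ i, ∑ j, L t i j k * L t i j l := by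
        rw [Fintype.sum_prod_type]
        simp only [Finset.mul_sum]
        refine Finset.sum_congr rfl fun i _ => Finset.sum_congr rfl fun j _ => ?_
        rw [← inv_pow]
        ring
      rw [h1]
      simp only [(hL t _).sum_mul]
      rw [hr, Real.sq_sqrt hnR.le]
      split_ifs
      · simp only [Finset.sum_const, Finset.card_univ, Fintype.card_fin, nsmul_eq_mul]
        rw [← Nat.cast_mul]
        exact inv_mul_cancel₀ hnR.ne'
      · simp)
  rw [hE_var] at hclt
  -- Slutsky: it remains to show that the estimator error minus the orthogonal contrast vanishes in
  -- probability.
  refine tendstoInDistribution_of_tendstoInMeasure_sub _ _ hclt ?_ hmeasT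
  have hdom := tendstoInMeasure_zero_const_mul (q : ℝ) (tendstoInMeasure_zero_add
    (tendstoInMeasure_zero_const_mul 11 (tendstoInMeasure_zero_sum Finset.univ
      fun k _ => tendstoInMeasure_zero_add (tendstoInMeasure_zero_abs (hN k))
        (tendstoInMeasure_zero_const_mul 2 (tendstoInMeasure_zero_add
          (tendstoInMeasure_zero_const_mul K (tendstoInMeasure_zero_sum Finset.univ
            fun i _ => tendstoInMeasure_zero_abs (hA i)))
          (tendstoInMeasure_zero_sum Finset.univ fun i _ => tendstoInMeasure_zero_abs (hE i))))))
    (tendstoInMeasure_zero_const_mul 10 (tendstoInMeasure_zero_sum Finset.univ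
      fun k _ => tendstoInMeasure_zero_abs (hG k))))
  refine tendstoInMeasure_zero_of_dominated hdom hbad ?_
  have hδq : ∀ᶠ t in atTop, 10 * q * δ t ≤ 1 := by
    have : Tendsto (fun t => 10 * q * δ t) atTop (𝓝 0) := by simpa using hD.const_mul (10 * (q : ℝ))
    exact this.eventually_le_const one_pos
  filter_upwards [hn.eventually_gt_atTop 0, hD.eventually_le_const one_pos, hδq] with t ht h1 h2
  filter_upwards [hgood t] with ω hω hb
  obtain ⟨hA0, hE0, hK⟩ := hω hb
  have hbound := (F t).abs_scaled_slope_error_sub_le (s t) ht (hL t) (hδ0 t) h1 h2 (hDδ t) hA0 hE0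
    β (a t) (e t) ω hK
  refine (EuclideanSpace.norm_le_sum_abs _).trans ?_
  have hsum : ∀ f : Fin q → ℝ, ∀ M, (∀ k, f k ≤ M) → ∑ k, f k ≤ q * M := by
    intro f M h
    refine (Finset.sum_le_sum fun k _ => h k).trans ?_
    simp
  refine hsum _ _ fun k => ?_
  have hr' : √((R * m t : ℕ) : ℝ) = r t := rfl
  have hri : 0 ≤ (r t)⁻¹ := inv_nonneg.2 (hr0 t)
  convert hbound k using 1
  · simp only [Pi.sub_apply, slopePart, PiLp.sub_apply, PiLp.smul_apply, smul_eq_mul, hXdef,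
      Fintype.sum_prod_type, mul_assoc, Finset.mul_sum, hr']
  · have e1 : ∀ k, (r t)⁻¹ * |∑ i, ∑ j, ((F t).subZ (s t) i - L t i) j k * e t i (s t i j) ω| =
        |∑ v, ((r t)⁻¹ * ((F t).subZ (s t) v.1 - L t v.1) v.2 k) * X t v ω| := by
      intro k
      rw [← abs_of_nonneg hri, ← abs_mul, abs_of_nonneg hri]
      simp only [hXdef, Fintype.sum_prod_type, Finset.mul_sum, mul_assoc]
    have e2 : δ t * ∑ k, |(r t)⁻¹ * ∑ i, ∑ j, L t i j k * e t i (s t i j) ω| =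
        ∑ k, |∑ v, (δ t * ((r t)⁻¹ * L t v.1 v.2 k)) * X t v ω| := by
      rw [Finset.mul_sum]
      refine Finset.sum_congr rfl fun k _ => ?_
      rw [← abs_of_nonneg (hδ0 t), ← abs_mul, abs_of_nonneg (hδ0 t)]
      simp only [hXdef, Fintype.sum_prod_type, Finset.mul_sum, mul_assoc]
    have e3 : (r t)⁻¹ * (δ t * ∑ i, |∑ j, e t i (s t i j) ω|) =
        ∑ i, |∑ v, (if v.1 = i then (r t)⁻¹ * δ t else 0) * X t v ω| := by
      rw [← mul_assoc, Finset.mul_sum]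
      refine Finset.sum_congr rfl fun i _ => ?_
      have h0 : 0 ≤ (r t)⁻¹ * δ t := mul_nonneg hri (hδ0 t)
      rw [← abs_of_nonneg h0, ← abs_mul, abs_of_nonneg h0, Fintype.sum_prod_type,
        Finset.sum_eq_single i]
      · simp [hXdef, Finset.mul_sum]
      · intro i' _ hi'
        simp [hi']
      · simp
    have e4 : (r t)⁻¹ * (K * ∑ i, |a t i ω|) = K * ∑ i, |∑ _v : Unit, (r t)⁻¹ * a t i ω| := by
      simp only [Finset.univ_unique, Finset.sum_const, Finset.card_singleton, one_smul, abs_mul,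
        abs_of_nonneg hri, ← Finset.mul_sum]
      ring
    simp only [hr']
    rw [mul_assoc 10, e2]
    simp only [mul_add (r t)⁻¹, e1, e3, e4]
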